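/- For $x,y\in\mathbb{Z}^3$ let $d_2(x,y)=\bigl(\sum_{i=1}^3 (x_i-y_i)^2\bigr)^{1/2}$, and let $\mathcal{D}=\{d_2(x,y): x,y\in\mathbb{Z}^3\}$ be the set of achievable distances. A code $C\subseteq\mathbb{Z}^3$ is called perfect if there is $\rho>0$ such that for every $z\in\mathbb{Z}^3$ there is exactly one $x\in C$ with $d_2(x,z)\le\rho$. The packing radius of $C$ is the largest $r\in\mathcal{D}$ such that the closed balls $\{z\in\mathbb{Z}^3: d_2(x,z)\le r\}$, $x\in C$, are pairwise disjoint. A perfect code with packing radius $r$ is called $r$-perfect; it is linear if it is an additive subgroup of $\mathbb{Z}^3$. Theorem. If $r>0$ and there is a linear $r$-perfect code in $\mathbb{Z}^3$ in the $\ell_2$ metric, then $r=1$ or $r=\sqrt3$. Both radii occur: the lattice with basis $\{(1,0,2),(0,1,4),(0,0,7)\}$, which is the kernel of the homomorphism $\mathbb{Z}^3\to\mathbb{Z}/7\mathbb{Z}$, $(x,y,z)\mapsto x+2y+3z$, is a $1$-perfect code, and the lattice with basis $\{(3,8,0),(0,3,2),(0,0,3)\}$, which is the kernel of the homomorphism $\mathbb{Z}^3\to\mathbb{Z}/27\mathbb{Z}$,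 $(x,y,z)\mapsto x+3y+9z$, is a $\sqrt3$-perfect code. -/

import Mathlib

namespace PerfectCode

/-- The `ℓ₂` distance between two points of `ℤⁿ`. -/
noncomputable def l2Dist {n : ℕ} (x y : Fin n → ℤ) : ℝ :=
  Real.sqrt (∑ i, ((x i : ℝ) - (y i : ℝ)) ^ 2)

/-- The closed ball in `ℤⁿ` for the `ℓ₂` metric. -/
def l2Ball {n : ℕ} (x : Fin n → ℤ) (r : ℝ) : Set (Fin n → ℤ) :=
  {z | l2Dist x z ≤ r}

/-- The set of distances achieved by pairs of points of `ℤⁿ` in the `ℓ₂` metric. -/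
def distanceSet (n : ℕ) : Set ℝ :=
  {d | ∃ x y : Fin n → ℤ, l2Dist x y = d}

/-- A code `C ⊆ ℤⁿ` is perfect if, for some `ρ > 0`, every point of `ℤⁿ` lies within distance `ρ`
of exactly one codeword. -/
def IsPerfect {n : ℕ} (C : Set (Fin n → ℤ)) : Prop :=
  ∃ ρ : ℝ, 0 < ρ ∧ ∀ z : Fin n → ℤ, ∃! x, x ∈ C ∧ l2Dist x z ≤ ρ

/-- `r` is the packing radius of `C`: the largest achievable distance such that the closed balls of
that radius centred at distinct codewords are disjoint. -/
def IsPackingRadius {n : ℕ} (C : Set (Fin n → ℤ)) (r : ℝ) : Prop :=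
  IsGreatest {ρ : ℝ | ρ ∈ distanceSet n ∧
    ∀ x ∈ C, ∀ y ∈ C, x ≠ y → Disjoint (l2Ball x ρ) (l2Ball y ρ)} r

/-- An `r`-perfect code is a perfect code whose packing radius is `r`. -/
def IsRPerfect {n : ℕ} (C : Set (Fin n → ℤ)) (r : ℝ) : Prop :=
  IsPerfect C ∧ IsPackingRadius C r

/-- The additive homomorphism `ℤ³ → ℤ/mℤ`, `(x, y, z) ↦ a x + b y + c z`. -/
def linHom (m : ℕ) (a b c : ℤ) : (Fin 3 → ℤ) →+ ZMod m where
  toFun v := ((a * v 0 + b * v 1 + c * v 2 : ℤ) : ZMod m)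
  map_zero' := by simp
  map_add' v w := by simp only [Pi.add_apply]; push_cast; ring

/-- The vectors `(1,0,2), (0,1,4), (0,0,7)`. -/
def basisAlpha : Fin 3 → Fin 3 → ℤ := ![![1, 0, 2], ![0, 1, 4], ![0, 0, 7]]

/-- The vectors `(3,8,0), (0,3,2), (0,0,3)`. -/
def basisBeta : Fin 3 → Fin 3 → ℤ := ![![3, 8, 0], ![0, 3, 2], ![0, 0, 3]]

end PerfectCode

namespace PerfectCode

/-! A linear `r`-perfect code is a subgroup `Λ` for which the translates of the ball of squared
radius `n = r²` tile `ℤ³` (`IsTiling`).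

For large `n` this fails as it does for round balls in space. Let `v` be a shortest nonzero element
of `Λ`. Pushing `v/2` off orthogonally to `v` and rounding gives an integer point outside the balls
at `0` and `v`. Any other lattice point is at distance at least `|v|` from both `0` and `v`, hence
at least `(√3/2)|v|` from `v/2`. Since `|v| ≥ 2r - 1` (`IsTiling.two_mul_sqrt_sub_one_le`), it is
too far away to cover that integer point once `r ≥ 10` (`IsTiling.lt_hundred`).

For `n < 100` a finite search remains (`excludes_testPoints`). Test points outside the ball at `0`
must be covered by nonzero lattice points. The packing condition leaves finitely many candidates for
these, and every simultaneous choice produces a nonzero lattice vector that is a sum of two points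
of the ball. Only `n = 1` and `n = 3` escape; they are realised by homomorphisms that are bijective
from the ball onto a cyclic group. -/

/-- The squared Euclidean norm of a point of `ℤ³`. -/
def normSq (v : Fin 3 → ℤ) : ℤ := v 0 ^ 2 + v 1 ^ 2 + v 2 ^ 2

lemma normSq_nonneg (v : Fin 3 → ℤ) : 0 ≤ normSq v := by
  unfold normSq; positivity

lemma normSq_sub_comm (v w : Fin 3 → ℤ) : normSq (v - w) = normSq (w - v) := by
  simp only [normSq, Pi.sub_apply]; ring

lemma normSq_eq_zero {v : Fin 3 → ℤ} : normSq v = 0 ↔ v = 0 := by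
  constructor
  · intro h
    unfold normSq at h
    have h0 : v 0 = 0 := by nlinarith [sq_nonneg (v 0), sq_nonneg (v 1), sq_nonneg (v 2)]
    have h1 : v 1 = 0 := by nlinarith [sq_nonneg (v 0), sq_nonneg (v 1), sq_nonneg (v 2)]
    have h2 : v 2 = 0 := by nlinarith [sq_nonneg (v 0), sq_nonneg (v 1), sq_nonneg (v 2)]
    ext i; fin_cases i <;> simp [h0, h1, h2]
  · rintro rfl; simp [normSq]

lemma l2Dist_eq_sqrt (x y : Fin 3 → ℤ) : l2Dist x y = √(normSq (x - y) : ℝ) := by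
  simp [l2Dist, normSq, Fin.sum_univ_three]

lemma l2Dist_comm (x y : Fin 3 → ℤ) : l2Dist x y = l2Dist y x := by
  rw [l2Dist_eq_sqrt, l2Dist_eq_sqrt, normSq_sub_comm]

lemma l2Dist_le_sqrt_iff {x y : Fin 3 → ℤ} {n : ℕ} :
    l2Dist x y ≤ √(n : ℝ) ↔ normSq (x - y) ≤ n := by
  rw [l2Dist_eq_sqrt, Real.sqrt_le_sqrt_iff (by positivity)]
  exact_mod_cast Iff.rfl

/-! ### Perfect linear codes as lattice tilings. -/

/-- The translates of the ball of squared radius `n` by the elements of `Λ` tile `ℤ³`. -/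
structure IsTiling (n : ℕ) (Λ : AddSubgroup (Fin 3 → ℤ)) : Prop where
  packing : ∀ v ∈ Λ, v ≠ 0 → ∀ z, normSq z ≤ n → ¬ normSq (v - z) ≤ n
  covering : ∀ z, ∃ v ∈ Λ, normSq (z - v) ≤ n

lemma IsRPerfect.exists_isTiling {Λ : AddSubgroup (Fin 3 → ℤ)} {r : ℝ} (hr : 0 < r)
    (h : IsRPerfect (Λ : Set (Fin 3 → ℤ)) r) :
    ∃ n : ℕ, 0 < n ∧ r = √(n : ℝ) ∧ IsTiling n Λ := by
  obtain ⟨⟨ρ, -, hρ⟩, ⟨⟨⟨x, y, hxy⟩, hdisj⟩, hmax⟩⟩ := h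
  obtain ⟨n, hn⟩ := Int.eq_ofNat_of_zero_le (normSq_nonneg (x - y))
  have hrn : r = √(n : ℝ) := by rw [← hxy, l2Dist_eq_sqrt, hn]; simp
  refine ⟨n, ?_, hrn, ?_, ?_⟩
  · rcases Nat.eq_zero_or_pos n with rfl | h
    · simp [hrn] at hr
    · exact h
  · intro v hv hv0 z hz hvz
    have hd := Set.disjoint_left.1 (hdisj 0 Λ.zero_mem v hv hv0.symm)
    refine hd (a := z) ?_ ?_
    · change l2Dist 0 z ≤ r
      rw [hrn, l2Dist_le_sqrt_iff, normSq_sub_comm, sub_zero]; exact hz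
    · change l2Dist v z ≤ r
      rw [hrn, l2Dist_le_sqrt_iff]; exact hvz
  · intro z
    obtain ⟨v, ⟨hv, hvz⟩, -⟩ := hρ z
    refine ⟨v, hv, ?_⟩
    rw [normSq_sub_comm, ← l2Dist_le_sqrt_iff, ← hrn]
    -- The distance from `v` to `z` is at most `ρ`, so balls of that radius are disjoint by
    -- uniqueness; maximality of `r` bounds it by `r`.
    refine hmax ⟨⟨v, z, rfl⟩, fun a ha b hb hab => Set.disjoint_left.2 fun c hca hcb => hab ?_⟩
    exact (hρ c).unique ⟨ha, le_trans hca hvz⟩ ⟨hb, le_trans hcb hvz⟩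

/-- The vector `u` makes `√n` an achievable distance. No larger distance works: a vector of that
length lies outside the ball at `0`, so it is covered from some `v ≠ 0`, and the enlarged balls at
`0` and `v` share it. -/
lemma IsTiling.isRPerfect {Λ : AddSubgroup (Fin 3 → ℤ)} {n : ℕ} (h : IsTiling n Λ) (hn : 0 < n)
    {u : Fin 3 → ℤ} (hu : normSq u = n) : IsRPerfect (Λ : Set (Fin 3 → ℤ)) √(n : ℝ) := by
  have key : ∀ x ∈ Λ, ∀ y ∈ Λ, ∀ z, l2Dist x z ≤ √(n : ℝ) → l2Dist y z ≤ √(n : ℝ) → x = y := by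
    intro x hx y hy z hxz hyz
    by_contra hxy
    rw [l2Dist_le_sqrt_iff] at hxz hyz
    refine h.packing (x - y) (Λ.sub_mem hx hy) (sub_ne_zero.2 hxy) (x - z) hxz ?_
    rw [sub_sub_sub_cancel_left, normSq_sub_comm]
    exact hyz
  refine ⟨⟨√(n : ℝ), by positivity, fun z => ?_⟩, ⟨⟨u, 0, ?_⟩, ?_⟩, ?_⟩
  · obtain ⟨v, hv, hvz⟩ := h.covering z
    have hvz' : l2Dist v z ≤ √(n : ℝ) := by rwa [l2Dist_le_sqrt_iff, normSq_sub_comm]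
    exact ⟨v, ⟨hv, hvz'⟩, fun w hw => key w hw.1 v hv z hw.2 hvz'⟩
  · rw [l2Dist_eq_sqrt, sub_zero, hu]; simp
  · intro x hx y hy hxy
    exact Set.disjoint_left.2 fun z hxz hyz => hxy (key x hx y hy z hxz hyz)
  · rintro ρ ⟨⟨x, y, rfl⟩, hdisj⟩
    by_contra! hlt
    obtain ⟨v, hv, hvz⟩ := h.covering (x - y)
    have h0 : ¬ normSq (x - y) ≤ n := by
      rw [← l2Dist_le_sqrt_iff]; exact not_le.2 hlt
    have hv0 : v ≠ 0 := by
      rintro rfl; rw [sub_zero] at hvz; exact h0 hvz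
    have hd := Set.disjoint_left.1 (hdisj 0 Λ.zero_mem v hv hv0.symm)
    refine hd (a := x - y) ?_ ?_
    · change l2Dist 0 (x - y) ≤ l2Dist x y
      rw [l2Dist_comm, l2Dist_eq_sqrt, l2Dist_eq_sqrt, sub_zero]
    · change l2Dist v (x - y) ≤ l2Dist x y
      rw [l2Dist_comm]
      exact (l2Dist_le_sqrt_iff.2 hvz).trans hlt.le

/-! ### Lengths of lattice vectors. -/

/-- A nonzero vector of a tiling lattice has length at least `2 √n - 1`. -/
lemma IsTiling.two_mul_sqrt_sub_one_le {n : ℕ} {Λ : AddSubgroup (Fin 3 → ℤ)} (h : IsTiling n Λ)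
    {v : Fin 3 → ℤ} (hv : v ∈ Λ) (hv0 : v ≠ 0) : 2 * √(n : ℝ) - 1 ≤ √(normSq v : ℝ) := by
  -- The points `(v + e)/2` and `(v - e)/2` sum to `v`, so one of them is outside the ball and has
  -- squared norm at least `n + 1`. Expanding and using `|e|² ≤ 3` turns `4n + 4` into `4n + 1`.
  have half : ∀ e₀ e₁ e₂ : ℤ, e₀ % 2 = v 0 % 2 → e₁ % 2 = v 1 % 2 → e₂ % 2 = v 2 % 2 →
      e₀ ^ 2 + e₁ ^ 2 + e₂ ^ 2 ≤ 3 →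
      4 * (n : ℤ) + 1 ≤ normSq v + 2 * |v 0 * e₀ + v 1 * e₁ + v 2 * e₂| := by
    intro e₀ e₁ e₂ h₀ h₁ h₂ he
    obtain ⟨x, hx⟩ : (2 : ℤ) ∣ v 0 + e₀ := by omega
    obtain ⟨y, hy⟩ : (2 : ℤ) ∣ v 1 + e₁ := by omega
    obtain ⟨z, hz⟩ : (2 : ℤ) ∣ v 2 + e₂ := by omega
    have hp := h.packing v hv hv0 ![x, y, z]
    simp only [normSq, Pi.sub_apply, Matrix.cons_val] at hp ⊢
    obtain rfl : e₀ = 2 * x - v 0 := by omega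
    obtain rfl : e₁ = 2 * y - v 1 := by omega
    obtain rfl : e₂ = 2 * z - v 2 := by omega
    by_cases hle : x ^ 2 + y ^ 2 + z ^ 2 ≤ n
    · have := not_le.1 (hp hle)
      have := neg_abs_le (v 0 * (2 * x - v 0) + v 1 * (2 * y - v 1) + v 2 * (2 * z - v 2))
      nlinarith
    · have := not_le.1 hle
      have := le_abs_self (v 0 * (2 * x - v 0) + v 1 * (2 * y - v 1) + v 2 * (2 * z - v 2))
      nlinarith
  have hmod : ∀ i, (v i % 2) ^ 2 ≤ 1 := fun i => by
    have : 0 ≤ v i % 2 ∧ v i % 2 ≤ 1 := by omega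
    nlinarith
  have hsq : ∀ i, (v i * (v i % 2)) ^ 2 ≤ v i ^ 2 := fun i => by
    rw [mul_pow]; exact mul_le_of_le_one_right (sq_nonneg _) (hmod i)
  -- Over the four sign patterns the squares `(a ± b ± c)²` average to `a² + b² + c² ≤ |v|²`, so
  -- some pattern gives `s² ≤ |v|²`.
  obtain ⟨s, hs, hs'⟩ : ∃ s : ℤ, 4 * (n : ℤ) + 1 ≤ normSq v + 2 * |s| ∧ s ^ 2 ≤ normSq v := by
    have hbd : (v 0 % 2) ^ 2 + (v 1 % 2) ^ 2 + (v 2 % 2) ^ 2 ≤ 3 := by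
      linarith [hmod 0, hmod 1, hmod 2]
    by_contra! hcon
    have k₁ := hcon _ (half (v 0 % 2) (v 1 % 2) (v 2 % 2) (by omega) (by omega) (by omega) hbd)
    have k₂ := hcon _ (half (v 0 % 2) (v 1 % 2) (-(v 2 % 2)) (by omega) (by omega) (by omega)
      (by rwa [neg_sq]))
    have k₃ := hcon _ (half (v 0 % 2) (-(v 1 % 2)) (v 2 % 2) (by omega) (by omega) (by omega)
      (by rwa [neg_sq]))
    have k₄ := hcon _ (half (v 0 % 2) (-(v 1 % 2)) (-(v 2 % 2)) (by omega) (by omega) (by omega)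
      (by rwa [neg_sq, neg_sq]))
    have e₀ := hsq 0
    have e₁ := hsq 1
    have e₂ := hsq 2
    simp only [normSq, mul_neg] at k₁ k₂ k₃ k₄
    generalize v 0 * (v 0 % 2) = a at *
    generalize v 1 * (v 1 % 2) = b at *
    generalize v 2 * (v 2 % 2) = c at *
    linarith
  have hN : (0 : ℝ) ≤ normSq v := by exact_mod_cast normSq_nonneg v
  have hs1 : (4 * n + 1 : ℝ) ≤ normSq v + 2 * |(s : ℝ)| := by exact_mod_cast hs
  have hs2 : |(s : ℝ)| ≤ √(normSq v : ℝ) := Real.abs_le_sqrt (by exact_mod_cast hs')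
  have h1 := Real.sq_sqrt hN
  have h2 := Real.sq_sqrt (Nat.cast_nonneg (α := ℝ) n)
  -- With `N = |v|²`, the bound `4n + 1 ≤ N + 2√N` says `4n + 2 ≤ (√N + 1)²`.
  by_contra! hlt
  nlinarith [Real.sqrt_nonneg (normSq v : ℝ), Real.sqrt_nonneg (n : ℝ)]

lemma IsTiling.exists_ne_zero {n : ℕ} {Λ : AddSubgroup (Fin 3 → ℤ)} (h : IsTiling n Λ) :
    ∃ v ∈ Λ, v ≠ 0 := by
  obtain ⟨v, hv, hvz⟩ := h.covering ![(n : ℤ) + 1, 0, 0]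
  refine ⟨v, hv, ?_⟩
  rintro rfl
  simp [normSq] at hvz
  nlinarith

lemma IsTiling.exists_minimal {n : ℕ} {Λ : AddSubgroup (Fin 3 → ℤ)} (h : IsTiling n Λ) :
    ∃ v ∈ Λ, v ≠ 0 ∧ ∀ w ∈ Λ, w ≠ 0 → normSq v ≤ normSq w := by
  obtain ⟨v, ⟨hv, hv0⟩, hmin⟩ := exists_minimalFor_of_wellFoundedLT
    (fun v : Fin 3 → ℤ => v ∈ Λ ∧ v ≠ 0) (fun v => (normSq v).toNat) h.exists_ne_zero
  refine ⟨v, hv, hv0, fun w hw hw0 => ?_⟩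
  have := normSq_nonneg v
  have := normSq_nonneg w
  by_contra! hlt
  have := hmin ⟨hw, hw0⟩ (by dsimp only; omega)
  dsimp only at this
  omega

/-! ### Large radii. -/

/-- The inclusion of `ℤ³` into Euclidean space. -/
noncomputable def toEuclidean (v : Fin 3 → ℤ) : EuclideanSpace ℝ (Fin 3) :=
  WithLp.toLp 2 fun i => (v i : ℝ)

lemma norm_toEuclidean (v : Fin 3 → ℤ) : ‖toEuclidean v‖ = √(normSq v : ℝ) := by
  simp [EuclideanSpace.norm_eq, toEuclidean, normSq, Fin.sum_univ_three]

lemma toEuclidean_sub (v w : Fin 3 → ℤ) :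
    toEuclidean (v - w) = toEuclidean v - toEuclidean w := by
  ext i; simp [toEuclidean]

/-- Rounding each coordinate moves a point by at most `√3/2 < 7/8`. -/
lemma exists_norm_toEuclidean_sub_lt (p : EuclideanSpace ℝ (Fin 3)) :
    ∃ z, ‖toEuclidean z - p‖ < 7 / 8 := by
  refine ⟨fun i => round (p i), ?_⟩
  have hr : ∀ i, ((round (p i) : ℝ) - p i) ^ 2 ≤ 1 / 4 := fun i => by
    have := abs_le.1 (abs_sub_round (p i))
    nlinarith
  rw [EuclideanSpace.norm_eq, Real.sqrt_lt' (by norm_num)]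
  simp only [toEuclidean, PiLp.sub_apply, Real.norm_eq_abs, sq_abs, Fin.sum_univ_three]
  linarith [hr 0, hr 1, hr 2]

lemma exists_unit_inner_eq_zero (p : EuclideanSpace ℝ (Fin 3)) :
    ∃ w : EuclideanSpace ℝ (Fin 3), ‖w‖ = 1 ∧ inner ℝ p w = 0 := by
  have hne : (Submodule.span ℝ {p})ᗮ ≠ ⊥ := by
    intro hbot
    have h1 := (Submodule.span ℝ {p}).finrank_add_finrank_orthogonal
    have h2 := finrank_span_finset_le_card (R := ℝ) ({p} : Finset (EuclideanSpace ℝ (Fin 3)))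
    rw [Finset.coe_singleton, Set.finrank, Finset.card_singleton] at h2
    rw [hbot, finrank_bot, finrank_euclideanSpace_fin] at h1
    omega
  obtain ⟨w, hw, hw0⟩ := Submodule.exists_mem_ne_zero_of_ne_bot hne
  refine ⟨‖w‖⁻¹ • w, ?_, ?_⟩
  · rw [norm_smul, norm_inv, norm_norm, inv_mul_cancel₀ (norm_ne_zero_iff.2 hw0)]
  · rw [inner_smul_right, Submodule.mem_orthogonal_singleton_iff_inner_right.1 hw, mul_zero]

/-- A lattice tiling by balls of large radius is impossible: near the midpoint of a shortest
vector there is a point outside both balls, and no third ball can reach it. -/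
lemma IsTiling.lt_hundred {n : ℕ} {Λ : AddSubgroup (Fin 3 → ℤ)} (h : IsTiling n Λ) : n < 100 := by
  by_contra! hn
  set r := √(n : ℝ) with hr
  have hr10 : 10 ≤ r := by
    rw [hr]; apply Real.le_sqrt_of_sq_le; norm_num; exact_mod_cast hn
  obtain ⟨v, hv, hv0, hmin⟩ := h.exists_minimal
  have hlong := h.two_mul_sqrt_sub_one_le hv hv0
  rw [← norm_toEuclidean] at hlong
  have hmin' : ∀ w ∈ Λ, w ≠ 0 → ‖toEuclidean v‖ ≤ ‖toEuclidean w‖ := fun w hw hw0 => by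
    rw [norm_toEuclidean, norm_toEuclidean]
    exact Real.sqrt_le_sqrt (by exact_mod_cast hmin w hw hw0)
  have hball : ∀ w : Fin 3 → ℤ, ‖toEuclidean w‖ ≤ r ↔ normSq w ≤ n := fun w => by
    rw [norm_toEuclidean, hr, Real.sqrt_le_sqrt_iff (by positivity)]
    exact_mod_cast Iff.rfl
  obtain ⟨w, hw1, hwv⟩ := exists_unit_inner_eq_zero (toEuclidean v)
  set x := toEuclidean v with hx
  -- Chosen so that `(r - 1/2)² + t² = (r + 7/8)²`, where `r - 1/2` bounds `|x|/2` from below and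
  -- `7/8` absorbs the rounding.
  set t := √(11 / 4 * r + 33 / 64) with ht
  have ht0 : 0 ≤ t := Real.sqrt_nonneg _
  have ht2 : t ^ 2 = 11 / 4 * r + 33 / 64 := Real.sq_sqrt (by linarith)
  have hbig : ∀ s : ℝ, s ^ 2 = 1 / 4 → r + 7 / 8 ≤ ‖s • x + t • w‖ := fun s hs => by
    apply le_of_sq_le_sq _ (norm_nonneg _)
    rw [norm_add_sq_real, inner_smul_left, inner_smul_right, hwv, norm_smul, norm_smul, mul_pow,
      mul_pow, hw1, Real.norm_eq_abs, Real.norm_eq_abs, sq_abs, sq_abs, hs, ht2]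
    simp only [mul_zero]
    nlinarith
  obtain ⟨z, hz⟩ := exists_norm_toEuclidean_sub_lt ((1 / 2 : ℝ) • x + t • w)
  obtain ⟨u, hu, huz⟩ := h.covering z
  rw [← hball, toEuclidean_sub] at huz
  have hu0 : u ≠ 0 := by
    rintro rfl
    have h1 : toEuclidean 0 = 0 := by ext i; simp [toEuclidean]
    rw [h1, sub_zero] at huz
    have h2 := hbig (1 / 2) (by norm_num)
    have h3 := norm_sub_norm_le ((1 / 2 : ℝ) • x + t • w) (toEuclidean z)
    rw [norm_sub_rev] at h3
    linarith
  have huv : u - v ≠ 0 := by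
    intro huv
    obtain rfl := sub_eq_zero.1 huv
    rw [← hx] at huz
    have h2 := hbig (-1 / 2) (by norm_num)
    have h3 := norm_sub_norm_le ((-1 / 2 : ℝ) • x + t • w) (toEuclidean z - x)
    rw [norm_sub_rev (_ + _), show toEuclidean z - x - ((-1 / 2 : ℝ) • x + t • w)
      = toEuclidean z - ((1 / 2 : ℝ) • x + t • w) by module] at h3
    linarith
  have hu1 := hmin' u hu hu0
  have hu2 := hmin' (u - v) (Λ.sub_mem hu hv) huv
  rw [toEuclidean_sub, ← hx] at hu2
  -- As `u` and `u - x` are both at least as long as `x`, this gives `|u - x/2|² ≥ (3/4)|x|² ≥ 3(r -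
  -- 1/2)²`.
  have hpar := parallelogram_law_with_norm ℝ (toEuclidean u - (1 / 2 : ℝ) • x) ((1 / 2 : ℝ) • x)
  rw [show toEuclidean u - (1 / 2 : ℝ) • x + (1 / 2 : ℝ) • x = toEuclidean u by module,
    show toEuclidean u - (1 / 2 : ℝ) • x - (1 / 2 : ℝ) • x = toEuclidean u - x by module,
    norm_smul, Real.norm_of_nonneg (by norm_num : (0 : ℝ) ≤ 1 / 2)] at hpar
  have hup : ‖toEuclidean u - (1 / 2 : ℝ) • x‖ ≤ r + 7 / 8 + t := by
    have e : toEuclidean u - (1 / 2 : ℝ) • x = -(toEuclidean z - toEuclidean u)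
        + (toEuclidean z - ((1 / 2 : ℝ) • x + t • w)) + t • w := by module
    have h1 : ‖t • w‖ = t := by rw [norm_smul, hw1, mul_one, Real.norm_of_nonneg ht0]
    rw [e]
    refine (norm_add₃_le).trans ?_
    rw [norm_neg, h1]
    linarith
  have ht3 : t < 73 / 100 * r - 175 / 100 := by
    apply lt_of_pow_lt_pow_left₀ 2 (by linarith)
    rw [ht2]; nlinarith
  -- The factor `173/100` is just below `√3`, which yields the contradiction.
  have hup' : ‖toEuclidean u - (1 / 2 : ℝ) • x‖ ≤ 173 / 100 * (r - 1 / 2) := by linarith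
  have a1 := norm_nonneg (toEuclidean u - (1 / 2 : ℝ) • x)
  have a2 : ‖x‖ ^ 2 ≤ ‖toEuclidean u‖ ^ 2 := by gcongr
  have a3 : ‖x‖ ^ 2 ≤ ‖toEuclidean u - x‖ ^ 2 := by gcongr
  have a4 : (2 * r - 1) ^ 2 ≤ ‖x‖ ^ 2 := by gcongr; linarith
  have a5 : ‖toEuclidean u - (1 / 2 : ℝ) • x‖ ^ 2 ≤ (173 / 100 * (r - 1 / 2)) ^ 2 := by gcongr
  nlinarith

/-! ### Exhaustive search for small radii

The functions of this section are evaluated by the kernel, whence the explicit recursors and the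
unbundled operations on `ℕ` and `ℤ`. -/

/-- The point of `ℤ³` with the given coordinates. -/
def vec (p : ℤ × ℤ × ℤ) : Fin 3 → ℤ := ![p.1, p.2.1, p.2.2]

/-- The sum of three squares. -/
def sumSq (a b c : ℕ) : ℕ := Nat.add (Nat.add (Nat.mul a a) (Nat.mul b b)) (Nat.mul c c)

/-- Both triples have a sum of squares of at most `n`. -/
def bothFit (n a b c a' b' c' : ℕ) : Bool :=
  Nat.ble (sumSq a b c) n && Nat.ble (sumSq a' b' c') n

/-- Some way of halving `(a, b, c)`, rounding one half up and the other one down in each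
coordinate, leaves both halves in the ball of squared radius `n`. -/
def splits (n a b c : ℕ) : Bool :=
  bothFit n (Nat.div (Nat.succ a) 2) (Nat.div (Nat.succ b) 2) (Nat.div (Nat.succ c) 2)
    (Nat.div a 2) (Nat.div b 2) (Nat.div c 2) ||
  bothFit n (Nat.div (Nat.succ a) 2) (Nat.div (Nat.succ b) 2) (Nat.div c 2)
    (Nat.div a 2) (Nat.div b 2) (Nat.div (Nat.succ c) 2) ||
  bothFit n (Nat.div (Nat.succ a) 2) (Nat.div b 2) (Nat.div (Nat.succ c) 2)
    (Nat.div a 2) (Nat.div (Nat.succ b) 2) (Nat.div c 2) ||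
  bothFit n (Nat.div (Nat.succ a) 2) (Nat.div b 2) (Nat.div c 2)
    (Nat.div a 2) (Nat.div (Nat.succ b) 2) (Nat.div (Nat.succ c) 2)

/-- Let the steps `f (k - 1)`, …, `f 0` extend the list `l` one after the other, and apply `P` to the
result. The continuation makes the kernel evaluate the whole list before it is used. -/
noncomputable def collect {α : Type*} (k : ℕ) (f : ℕ → List α → (List α → Bool) → Bool) :
    List α → (List α → Bool) → Bool :=
  Nat.rec (fun l P => P l) (fun i ih l P => f i l fun l' => ih l' P) k

/-- The displacement with index `i`, between `-9` and `9`. -/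
def disp (i : ℕ) : ℤ := Int.subNatNat i 9

/-- The predicate `P`, applied to the list of the points `v` within squared distance `hi < 100` of
`z` for which no halving of `v` lies in the ball of squared radius `lo`. -/
noncomputable def onCandidates (lo hi : ℕ) (z : ℤ × ℤ × ℤ) (P : List (ℤ × ℤ × ℤ) → Bool) : Bool :=
  collect 19 (fun i l P =>
    cond (Nat.ble (sumSq (Int.natAbs (disp i)) 0 0) hi) (collect 19 (fun j l P =>
      cond (Nat.ble (sumSq (Int.natAbs (disp i)) (Int.natAbs (disp j)) 0) hi)
        (collect 19 (fun k l P =>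
          cond (Nat.ble (sumSq (Int.natAbs (disp i)) (Int.natAbs (disp j))
              (Int.natAbs (disp k))) hi)
            (cond (splits lo (Int.natAbs (Int.add z.1 (disp i)))
                (Int.natAbs (Int.add z.2.1 (disp j))) (Int.natAbs (Int.add z.2.2 (disp k)))) (P l)
              (P ((Int.add z.1 (disp i), Int.add z.2.1 (disp j), Int.add z.2.2 (disp k)) :: l)))
            (P l)) l P) (P l)) l P) (P l)) [] P

/-- The points `v` and `w` cannot both belong to a lattice that tiles with the ball of squared
radius `n`. -/
def conflict (n : ℕ) (v w : ℤ × ℤ × ℤ) : Bool :=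
  Nat.ble 1 (sumSq (Int.natAbs (v.1 - w.1)) (Int.natAbs (v.2.1 - w.2.1))
    (Int.natAbs (v.2.2 - w.2.2))) &&
  splits n (Int.natAbs (v.1 - w.1)) (Int.natAbs (v.2.1 - w.2.1)) (Int.natAbs (v.2.2 - w.2.2))

/-- The points `s`, `s + v` and `s - v` for `s ∈ S`. -/
def extend (S : List (ℤ × ℤ × ℤ)) (v : ℤ × ℤ × ℤ) : List (ℤ × ℤ × ℤ) :=
  S ++ S.map (fun s => (s.1 + v.1, s.2.1 + v.2.1, s.2.2 + v.2.2)) ++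
    S.map (fun s => (s.1 - v.1, s.2.1 - v.2.1, s.2.2 - v.2.2))

/-- Branch over the choice of a lattice point from each of the lists `ls`, given that the lattice
contains `S`; the value is `true` if every branch ends in a conflict. -/
noncomputable def refutes (n : ℕ) (ls : List (List (ℤ × ℤ × ℤ))) : List (ℤ × ℤ × ℤ) → Bool :=
  List.rec (fun _ => false) (fun l _ ih S => l.all fun v =>
    cond (S.any (conflict n v)) true (ih (extend S v))) ls

/-- The predicate `P`, applied to the lists of candidates that can cover the test points `zs`. -/
noncomputable def onAllCandidates (lo hi : ℕ) (zs : List (ℤ × ℤ × ℤ)) :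
    (List (List (ℤ × ℤ × ℤ)) → Bool) → Bool :=
  List.rec (fun P => P [])
    (fun z _ ih P => onCandidates lo hi z fun l => ih fun ls => P (l :: ls)) zs

/-- For squared radii between `lo` and `hi`, every choice of lattice points that cover the test
points `zs` ends in a conflict. -/
noncomputable def excludes (lo hi : ℕ) (zs : List (ℤ × ℤ × ℤ)) : Bool :=
  onAllCandidates lo hi zs fun ls => refutes lo ls [(0, 0, 0)]

/-! ### Soundness of the search. -/

lemma normSq_eq_sumSq (v : Fin 3 → ℤ) :
    normSq v = (sumSq (v 0).natAbs (v 1).natAbs (v 2).natAbs : ℕ) := by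
  simp [normSq, sumSq, sq]

lemma exists_halves (a : ℤ) : ∃ x : ℤ, x.natAbs = Nat.div (Nat.succ a.natAbs) 2 ∧
    (a - x).natAbs = Nat.div a.natAbs 2 := by
  change ∃ x : ℤ, x.natAbs = (a.natAbs + 1) / 2 ∧ (a - x).natAbs = a.natAbs / 2
  rcases le_total 0 a with h | h
  · exact ⟨(a + 1) / 2, by omega, by omega⟩
  · exact ⟨a / 2, by omega, by omega⟩

lemma exists_of_splits {n : ℕ} {v : Fin 3 → ℤ}
    (h : splits n (v 0).natAbs (v 1).natAbs (v 2).natAbs = true) :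
    ∃ z, normSq z ≤ n ∧ normSq (v - z) ≤ n := by
  obtain ⟨x, hx, hx'⟩ := exists_halves (v 0)
  obtain ⟨y, hy, hy'⟩ := exists_halves (v 1)
  obtain ⟨z, hz, hz'⟩ := exists_halves (v 2)
  have key : ∀ a b c : ℤ, bothFit n a.natAbs b.natAbs c.natAbs (v 0 - a).natAbs (v 1 - b).natAbs
      (v 2 - c).natAbs = true → ∃ z, normSq z ≤ n ∧ normSq (v - z) ≤ n := by
    intro a b c h
    rw [bothFit, Bool.and_eq_true, Nat.ble_eq, Nat.ble_eq] at h
    refine ⟨![a, b, c], ?_, ?_⟩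
    · rw [normSq_eq_sumSq]; exact_mod_cast h.1
    · rw [normSq_eq_sumSq]; exact_mod_cast h.2
  simp only [splits, Bool.or_eq_true, ← hx, ← hx', ← hy, ← hy', ← hz, ← hz'] at h
  rcases h with ((h | h) | h) | h
  · exact key x y z h
  · exact key x y (v 2 - z) (by rwa [sub_sub_cancel])
  · exact key x (v 1 - y) z (by rwa [sub_sub_cancel])
  · exact key x (v 1 - y) (v 2 - z) (by rwa [sub_sub_cancel, sub_sub_cancel])

/-- The continuation-passing function `F` only adds elements to its list, among them all those
of `A`. -/
def Gathers {α : Type*} (F : List α → (List α → Bool) → Bool) (A : Set α) : Prop :=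
  ∀ l, ∃ l', (∀ P, F l P = P l') ∧ l ⊆ l' ∧ ∀ x ∈ A, x ∈ l'

lemma Gathers.collect {α : Type*} {f : ℕ → List α → (List α → Bool) → Bool} {A : ℕ → Set α}
    (h : ∀ i, Gathers (f i) (A i)) (k : ℕ) :
    Gathers (PerfectCode.collect k f) {x | ∃ i < k, x ∈ A i} := by
  induction k with
  | zero => exact fun l => ⟨l, fun P => rfl, List.Subset.refl l, by simp⟩
  | succ k ih =>
    intro l
    obtain ⟨l₁, h₁, hl₁, hA₁⟩ := h k l
    obtain ⟨l₂, h₂, hl₂, hA₂⟩ := ih l₁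
    refine ⟨l₂, fun P => ?_, List.Subset.trans hl₁ hl₂, ?_⟩
    · change f k l (fun l' => PerfectCode.collect k f l' P) = P l₂
      rw [h₁, h₂]
    · rintro x ⟨i, hi, hx⟩
      rcases Nat.lt_succ_iff_lt_or_eq.1 hi with h | rfl
      · exact hA₂ x ⟨i, h, hx⟩
      · exact hl₂ (hA₁ x hx)

lemma Gathers.cond {α : Type*} {F : List α → (List α → Bool) → Bool} {A : Set α}
    (h : Gathers F A) (b : Bool) :
    Gathers (fun l P => bif b then F l P else P l) {x | b = true ∧ x ∈ A} := by
  cases b with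
  | false => exact fun l => ⟨l, fun P => rfl, List.Subset.refl l, by simp⟩
  | true => simpa using h

lemma gathers_cons {α : Type*} (v : α) (b : Bool) :
    Gathers (fun l P => bif b then P l else P (v :: l)) {x | b = false ∧ x = v} := by
  cases b with
  | false => exact fun l => ⟨v :: l, fun P => rfl, List.subset_cons_self v l, by simp⟩
  | true => exact fun l => ⟨l, fun P => rfl, List.Subset.refl l, by simp⟩

/-- This is where the search window `-9, …, 9` relies on the bound `100`. -/
lemma exists_disp {n : ℕ} (hn : n < 100) {d : ℤ} (hd : d ^ 2 ≤ n) : ∃ i < 19, disp i = d := by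
  have h : -9 ≤ d ∧ d ≤ 9 := by constructor <;> nlinarith
  refine ⟨(d + 9).toNat, by omega, ?_⟩
  rw [disp, Int.subNatNat_eq_coe]
  omega

/-- Only completeness of the list matters: superfluous candidates would add branches to refute,
never hide one. -/
lemma onCandidates_eq {lo hi : ℕ} (hhi : hi < 100) (z : ℤ × ℤ × ℤ) :
    ∃ l, (∀ P, onCandidates lo hi z P = P l) ∧ ∀ v : ℤ × ℤ × ℤ, normSq (vec z - vec v) ≤ hi →
      splits lo v.1.natAbs v.2.1.natAbs v.2.2.natAbs = false → v ∈ l := by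
  obtain ⟨l, hl, -, hmem⟩ := Gathers.collect (fun i => Gathers.cond (Gathers.collect (fun j =>
    Gathers.cond (Gathers.collect (fun k => Gathers.cond (gathers_cons
      (Int.add z.1 (disp i), Int.add z.2.1 (disp j), Int.add z.2.2 (disp k))
      (splits lo (Int.natAbs (Int.add z.1 (disp i))) (Int.natAbs (Int.add z.2.1 (disp j)))
        (Int.natAbs (Int.add z.2.2 (disp k)))))
      (Nat.ble (sumSq (Int.natAbs (disp i)) (Int.natAbs (disp j)) (Int.natAbs (disp k))) hi)) 19)
      (Nat.ble (sumSq (Int.natAbs (disp i)) (Int.natAbs (disp j)) 0) hi)) 19)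
      (Nat.ble (sumSq (Int.natAbs (disp i)) 0 0) hi)) 19 []
  refine ⟨l, hl, fun v hvz hv => hmem v ?_⟩
  rw [normSq_sub_comm] at hvz
  simp only [normSq, vec, Pi.sub_apply, Matrix.cons_val] at hvz
  have n0 := sq_nonneg (v.1 - z.1)
  have n1 := sq_nonneg (v.2.1 - z.2.1)
  have n2 := sq_nonneg (v.2.2 - z.2.2)
  obtain ⟨i, hi', hdi⟩ := exists_disp hhi (d := v.1 - z.1) (by linarith)
  obtain ⟨j, hj', hdj⟩ := exists_disp hhi (d := v.2.1 - z.2.1) (by linarith)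
  obtain ⟨k, hk', hdk⟩ := exists_disp hhi (d := v.2.2 - z.2.2) (by linarith)
  have hs : ∀ a b c : ℤ, a ^ 2 + b ^ 2 + c ^ 2 ≤ hi →
      Nat.ble (sumSq a.natAbs b.natAbs c.natAbs) hi = true := by
    intro a b c h
    have := normSq_eq_sumSq ![a, b, c]
    simp only [normSq, Matrix.cons_val] at this
    rw [Nat.ble_eq]
    exact_mod_cast this ▸ h
  have e0 : Int.add z.1 (v.1 - z.1) = v.1 := add_sub_cancel _ _
  have e1 : Int.add z.2.1 (v.2.1 - z.2.1) = v.2.1 := add_sub_cancel _ _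
  have e2 : Int.add z.2.2 (v.2.2 - z.2.2) = v.2.2 := add_sub_cancel _ _
  refine ⟨i, hi', ?_, j, hj', ?_, k, hk', ?_, ?_, ?_⟩
  · exact hs (disp i) 0 0 (by rw [hdi]; linarith)
  · exact hs (disp i) (disp j) 0 (by rw [hdi, hdj]; linarith)
  · exact hs (disp i) (disp j) (disp k) (by rw [hdi, hdj, hdk]; exact hvz)
  · rw [hdi, hdj, hdk, e0, e1, e2]; exact hv
  · rw [hdi, hdj, hdk, e0, e1, e2]

lemma IsTiling.not_splits {n lo : ℕ} {Λ : AddSubgroup (Fin 3 → ℤ)} (h : IsTiling n Λ)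
    (hlo : lo ≤ n) {v : Fin 3 → ℤ} (hv : v ∈ Λ) (hv0 : v ≠ 0) :
    splits lo (v 0).natAbs (v 1).natAbs (v 2).natAbs = false := by
  rw [← Bool.not_eq_true]
  intro hs
  obtain ⟨z, hz, hz'⟩ := exists_of_splits hs
  have : (lo : ℤ) ≤ n := by exact_mod_cast hlo
  exact h.packing v hv hv0 z (hz.trans this) (hz'.trans this)

lemma IsTiling.not_conflict {n lo : ℕ} {Λ : AddSubgroup (Fin 3 → ℤ)} (h : IsTiling n Λ)
    (hlo : lo ≤ n) {v w : ℤ × ℤ × ℤ} (hv : vec v ∈ Λ) (hw : vec w ∈ Λ) :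
    conflict lo v w ≠ true := by
  intro hc
  rw [conflict, Bool.and_eq_true, Nat.ble_eq] at hc
  refine absurd hc.2 (Bool.not_eq_true _ ▸
    h.not_splits hlo (v := vec v - vec w) (Λ.sub_mem hv hw) fun h0 => ?_)
  have h1 := normSq_eq_sumSq (vec v - vec w)
  rw [normSq_eq_zero.2 h0] at h1
  have h2 : 0 = sumSq (Int.natAbs (v.1 - w.1)) (Int.natAbs (v.2.1 - w.2.1))
    (Int.natAbs (v.2.2 - w.2.2)) := by exact_mod_cast h1
  omega

lemma vec_add (v w : ℤ × ℤ × ℤ) :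
    vec (v.1 + w.1, v.2.1 + w.2.1, v.2.2 + w.2.2) = vec v + vec w := by
  simp [vec]

lemma vec_sub (v w : ℤ × ℤ × ℤ) :
    vec (v.1 - w.1, v.2.1 - w.2.1, v.2.2 - w.2.2) = vec v - vec w := by
  simp [vec]

/-- The branch that picks an actual lattice point from each list keeps `S` inside `Λ`, so it never
meets a conflict and reaches the empty list, where the value is `false`. -/
lemma IsTiling.not_refutes {n lo : ℕ} {Λ : AddSubgroup (Fin 3 → ℤ)} (h : IsTiling n Λ)
    (hlo : lo ≤ n) {ls : List (List (ℤ × ℤ × ℤ))} (hls : ∀ l ∈ ls, ∃ v ∈ l, vec v ∈ Λ)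
    {S : List (ℤ × ℤ × ℤ)} (hS : ∀ s ∈ S, vec s ∈ Λ) : refutes lo ls S ≠ true := by
  induction ls generalizing S with
  | nil => exact Bool.false_ne_true
  | cons l ls ih =>
    intro hr
    change l.all (fun v =>
      cond (S.any (conflict lo v)) true (refutes lo ls (extend S v))) = true at hr
    rw [List.all_eq_true] at hr
    obtain ⟨v, hvl, hv⟩ := hls l List.mem_cons_self
    have hvr := hr v hvl
    have hany : S.any (conflict lo v) = false := by
      rw [List.any_eq_false]
      exact fun s hs => h.not_conflict hlo hv (hS s hs)
    rw [hany, cond_false] at hvr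
    refine ih (fun l hl => hls l (List.mem_cons_of_mem _ hl)) (fun s hs => ?_) hvr
    simp only [extend, List.mem_append, List.mem_map] at hs
    rcases hs with (hs | ⟨s, hs, rfl⟩) | ⟨s, hs, rfl⟩
    · exact hS s hs
    · rw [vec_add]; exact Λ.add_mem (hS s hs) hv
    · rw [vec_sub]; exact Λ.sub_mem (hS s hs) hv

lemma IsTiling.onAllCandidates_eq {n lo hi : ℕ} {Λ : AddSubgroup (Fin 3 → ℤ)} (h : IsTiling n Λ)
    (hlo : lo ≤ n) (hn : n ≤ hi) (hhi : hi < 100) {zs : List (ℤ × ℤ × ℤ)}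
    (hzs : ∀ z ∈ zs, (hi : ℤ) < normSq (vec z)) :
    ∃ ls, (∀ P, onAllCandidates lo hi zs P = P ls) ∧ ∀ l ∈ ls, ∃ v ∈ l, vec v ∈ Λ := by
  induction zs with
  | nil => exact ⟨[], fun P => rfl, by simp⟩
  | cons z zs ih =>
    obtain ⟨l, hl, hmem⟩ := onCandidates_eq (lo := lo) hhi z
    obtain ⟨ls, hls, hlsΛ⟩ := ih fun z hz => hzs z (List.mem_cons_of_mem _ hz)
    refine ⟨l :: ls, fun P => ?_, ?_⟩
    · change onCandidates lo hi z (fun l => onAllCandidates lo hi zs fun ls => P (l :: ls)) = _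
      rw [hl, hls]
    · rw [List.forall_mem_cons]
      refine ⟨?_, hlsΛ⟩
      have hn' : (n : ℤ) ≤ hi := by exact_mod_cast hn
      obtain ⟨u, hu, huz⟩ := h.covering (vec z)
      obtain ⟨v, rfl⟩ : ∃ v, u = vec v := ⟨(u 0, u 1, u 2), by ext i; fin_cases i <;> rfl⟩
      refine ⟨v, hmem v (huz.trans hn') (h.not_splits hlo hu fun h0 => ?_), hu⟩
      rw [h0, sub_zero] at huz
      exact absurd (huz.trans hn') (not_le.2 (hzs z List.mem_cons_self))

/-- A tiling for `n` packs at every smaller squared radius and covers at every larger one, so one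
run with packing at `lo` and covering at `hi` treats the whole range. -/
lemma IsTiling.not_excludes {n lo hi : ℕ} {Λ : AddSubgroup (Fin 3 → ℤ)} (h : IsTiling n Λ)
    (hlo : lo ≤ n) (hn : n ≤ hi) (hhi : hi < 100) {zs : List (ℤ × ℤ × ℤ)}
    (hzs : ∀ z ∈ zs, (hi : ℤ) < normSq (vec z)) : excludes lo hi zs ≠ true := by
  obtain ⟨ls, hls, hlsΛ⟩ := h.onAllCandidates_eq hlo hn hhi hzs
  rw [excludes, hls]
  refine h.not_refutes hlo hlsΛ fun s hs => ?_
  rw [List.mem_singleton] at hs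
  subst hs
  convert Λ.zero_mem using 1
  ext i; fin_cases i <;> rfl

/-! ### The search for squared radii below 100. -/

/-- Ranges of squared radii, each with test points outside the balls of these radii that no tiling
lattice can cover. -/
def testPoints : List (ℕ × ℕ × List (ℤ × ℤ × ℤ)) := [
  (2, 2, [(1, 1, 1), (0, 2, 0), (0, 0, 2), (2, 0, 0)]),
  (4, 4, [(1, 2, 0), (0, 2, -1), (0, 2, 1), (1, -2, 0)]),
  (5, 5, [(1, -1, -2), (2, 1, -1), (1, 2, 1), (1, -2, 1)]),
  (6, 7, [(2, 0, 2), (3, 0, 1), (3, 0, 0)]),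
  (8, 8, [(3, 1, 0), (2, 1, 2), (2, 1, -2), (0, 0, 3)]),
  (9, 9, [(3, 0, 1), (3, -1, 0), (3, 0, -1), (3, 1, 0)]),
  (10, 10, [(3, 1, 1), (3, 1, -1)]),
  (11, 11, [(2, -2, 2), (2, -3, 0), (0, 2, -3)]),
  (12, 12, [(0, 0, 4), (0, 2, -3), (0, 4, 0)]),
  (13, 13, [(3, 2, 1), (1, 2, 3)]),
  (14, 16, [(3, 2, 2), (3, 3, 0)]),
  (17, 17, [(4, 1, 1), (4, 1, -1)]),
  (18, 19, [(4, 2, 0), (2, 4, 0)]),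
  (20, 20, [(4, 2, 1), (4, 2, -1)]),
  (21, 23, [(4, 3, 0), (5, 1, 0)]),
  (24, 24, [(3, 3, 3), (4, 3, 1)]),
  (25, 25, [(4, 3, 1), (4, 3, -1)]),
  (26, 28, [(5, 2, 0), (5, -2, 0)]),
  (29, 31, [(5, 2, 2), (5, 2, -2)]),
  (32, 32, [(5, 2, 2), (2, 5, 2)]),
  (33, 34, [(5, 3, 1), (3, 5, 1)]),
  (35, 35, [(4, 4, 2), (4, 4, -2)]),
  (36, 37, [(5, 3, 2), (3, 4, 4)]),
  (38, 40, [(4, 4, 3), (6, 2, 1)]),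
  (41, 43, [(6, 2, 2), (7, 0, 0)]),
  (44, 45, [(6, 3, 1), (6, 1, 3)]),
  (46, 49, [(5, 5, 0), (5, 4, 3)]),
  (50, 52, [(5, 4, 4), (2, 5, 5)]),
  (53, 56, [(7, 3, 0), (7, -3, 0)]),
  (57, 60, [(7, 3, 2), (8, 0, 0)]),
  (61, 64, [(5, 5, 4), (6, 2, 5)]),
  (65, 67, [(7, 4, 2), (7, 4, -2)]),
  (68, 69, [(6, 5, 3), (6, 5, -3)]),
  (70, 73, [(5, 5, 5), (7, 4, 3)]),
  (74, 80, [(8, 4, 1), (9, 0, 0)]),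
  (81, 84, [(6, 6, 4), (7, 6, 0)]),
  (85, 88, [(7, 6, 2), (3, 8, 4)]),
  (89, 93, [(9, 3, 2), (6, 6, 5)]),
  (94, 99, [(9, 4, 2), (4, 9, 2)])]

lemma exists_mem_testPoints :
    ∀ n < 100, n < 2 ∨ n = 3 ∨ ∃ t ∈ testPoints, t.1 ≤ n ∧ n ≤ t.2.1 := by
  decide +kernel

lemma lt_normSq_testPoints :
    ∀ t ∈ testPoints, t.2.1 < 100 ∧ ∀ z ∈ t.2.2, (t.2.1 : ℤ) < normSq (vec z) := by
  decide +kernel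

lemma excludes_testPoints : ∀ t ∈ testPoints, excludes t.1 t.2.1 t.2.2 = true := by
  decide +kernel

lemma IsTiling.eq_one_or_eq_three {n : ℕ} {Λ : AddSubgroup (Fin 3 → ℤ)} (h : IsTiling n Λ)
    (h0 : 0 < n) (hn : n < 100) : n = 1 ∨ n = 3 := by
  rcases exists_mem_testPoints n hn with h2 | h3 | ⟨t, ht, hlo, hhi⟩
  · omega
  · exact Or.inr h3
  · obtain ⟨h100, hz⟩ := lt_normSq_testPoints t ht
    exact absurd (excludes_testPoints t ht) (h.not_excludes hlo hhi h100 hz)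

/-! ### The two perfect codes. -/

lemma mem_ker_linHom {m : ℕ} {a b c : ℤ} {v : Fin 3 → ℤ} :
    v ∈ (linHom m a b c).ker ↔ (m : ℤ) ∣ a * v 0 + b * v 1 + c * v 2 := by
  rw [AddMonoidHom.mem_ker, ← ZMod.intCast_zmod_eq_zero_iff_dvd]
  exact Iff.rfl

lemma linearIndependent_basisAlpha : LinearIndependent ℤ basisAlpha := by
  rw [Fintype.linearIndependent_iff]
  intro g hg
  have h0 := congrFun hg 0
  have h1 := congrFun hg 1
  have h2 := congrFun hg 2
  simp [Fin.sum_univ_three, basisAlpha] at h0 h1 h2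
  intro i; fin_cases i <;> simp <;> omega

lemma linearIndependent_basisBeta : LinearIndependent ℤ basisBeta := by
  rw [Fintype.linearIndependent_iff]
  intro g hg
  have h0 := congrFun hg 0
  have h1 := congrFun hg 1
  have h2 := congrFun hg 2
  simp [Fin.sum_univ_three, basisBeta] at h0 h1 h2
  intro i; fin_cases i <;> simp <;> omega

lemma mem_closure_range_of_eq {b : Fin 3 → Fin 3 → ℤ} {v : Fin 3 → ℤ} (p q s : ℤ)
    (h : v = p • b 0 + q • b 1 + s • b 2) : v ∈ AddSubgroup.closure (Set.range b) := by
  have hb : ∀ i, b i ∈ AddSubgroup.closure (Set.range b) := fun i =>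
    AddSubgroup.subset_closure ⟨i, rfl⟩
  rw [h]
  exact add_mem (add_mem (zsmul_mem (hb 0) p) (zsmul_mem (hb 1) q)) (zsmul_mem (hb 2) s)

lemma closure_basisAlpha :
    AddSubgroup.closure (Set.range basisAlpha) = (linHom 7 1 2 3).ker := by
  apply le_antisymm
  · rw [AddSubgroup.closure_le]
    rintro _ ⟨i, rfl⟩
    rw [SetLike.mem_coe, mem_ker_linHom]
    fin_cases i <;> simp [basisAlpha]
  · intro v hv
    rw [mem_ker_linHom] at hv
    push_cast at hv
    obtain ⟨k, hk⟩ : (7 : ℤ) ∣ v 2 - 2 * v 0 - 4 * v 1 := by omega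
    refine mem_closure_range_of_eq (v 0) (v 1) k ?_
    ext i; fin_cases i <;> simp [basisAlpha]; omega

lemma closure_basisBeta :
    AddSubgroup.closure (Set.range basisBeta) = (linHom 27 1 3 9).ker := by
  apply le_antisymm
  · rw [AddSubgroup.closure_le]
    rintro _ ⟨i, rfl⟩
    rw [SetLike.mem_coe, mem_ker_linHom]
    fin_cases i <;> simp [basisBeta]
  · intro v hv
    rw [mem_ker_linHom] at hv
    push_cast at hv
    obtain ⟨p, hp⟩ : (3 : ℤ) ∣ v 0 := by omega
    obtain ⟨q, hq⟩ : (3 : ℤ) ∣ v 1 - 8 * p := by omega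
    obtain ⟨s, hs⟩ : (3 : ℤ) ∣ v 2 - 2 * q := by omega
    refine mem_closure_range_of_eq p q s ?_
    ext i; fin_cases i <;> simp [basisBeta] <;> omega

/-- A homomorphism that maps the ball of squared radius `n` bijectively onto its codomain has a
kernel that tiles. -/
lemma isTiling_ker_linHom {n m : ℕ} {a b c : ℤ}
    (hinj : ∀ v w : Fin 3 → ℤ, normSq v ≤ n → normSq w ≤ n →
      (m : ℤ) ∣ a * (v 0 - w 0) + b * (v 1 - w 1) + c * (v 2 - w 2) → v = w)
    (hsurj : ∀ t : ℤ, ∃ v : Fin 3 → ℤ, normSq v ≤ n ∧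
      (m : ℤ) ∣ t - (a * v 0 + b * v 1 + c * v 2)) :
    IsTiling n (linHom m a b c).ker := by
  constructor
  · intro v hv hv0 z hz hvz
    rw [mem_ker_linHom] at hv
    rw [normSq_sub_comm] at hvz
    have h := hinj z (z - v) hz hvz (by simpa using hv)
    exact hv0 (sub_eq_self.1 h.symm)
  · intro z
    obtain ⟨d, hd, ht⟩ := hsurj (a * z 0 + b * z 1 + c * z 2)
    refine ⟨z - d, ?_, by simpa using hd⟩
    rw [mem_ker_linHom]
    convert ht using 1
    simp only [Pi.sub_apply]; ring

/-- The ball consists of `0` and the six signed unit vectors, on which `x + 2y + 3z` takes the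
values `0, ±1, ±2, ±3`: each residue modulo 7 once. -/
lemma isTiling_one : IsTiling 1 (linHom 7 1 2 3).ker := by
  have hball : ∀ v : Fin 3 → ℤ, normSq v ≤ (1 : ℕ) → (∀ i, v i = -1 ∨ v i = 0 ∨ v i = 1) ∧
      (v 0 = 0 ∧ v 1 = 0 ∨ v 0 = 0 ∧ v 2 = 0 ∨ v 1 = 0 ∧ v 2 = 0) := by
    intro v hv
    simp only [normSq, Nat.cast_one] at hv
    have h0 := sq_nonneg (v 0)
    have h1 := sq_nonneg (v 1)
    have h2 := sq_nonneg (v 2)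
    have hpos : ∀ i, v i ≠ 0 → 0 < v i ^ 2 := fun i hi => by positivity
    refine ⟨fun i => ?_, ?_⟩
    · have : v i ^ 2 ≤ 1 := by fin_cases i <;> dsimp <;> linarith
      have : -1 ≤ v i ∧ v i ≤ 1 := by constructor <;> nlinarith
      omega
    · by_cases e0 : v 0 = 0 <;> by_cases e1 : v 1 = 0 <;> by_cases e2 : v 2 = 0 <;>
        simp only [e0, e1, e2, and_self, and_false, false_and, or_self, or_true, or_false]
      · linarith [hpos 1 e1, hpos 2 e2]
      · linarith [hpos 0 e0, hpos 2 e2]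
      · linarith [hpos 0 e0, hpos 1 e1]
      · linarith [hpos 0 e0, hpos 1 e1]
  apply isTiling_ker_linHom
  · intro v w hv hw h
    obtain ⟨hv, hv'⟩ := hball v hv
    obtain ⟨hw, hw'⟩ := hball w hw
    have := hv 0
    have := hv 1
    have := hv 2
    have := hw 0
    have := hw 1
    have := hw 2
    push_cast at h
    have : v 0 = w 0 ∧ v 1 = w 1 ∧ v 2 = w 2 := by
      rcases hv' with ⟨a, b⟩ | ⟨a, b⟩ | ⟨a, b⟩ <;> rcases hw' with ⟨c, d⟩ | ⟨c, d⟩ | ⟨c, d⟩ <;> omega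
    ext i; fin_cases i <;> simp [this]
  · intro t
    have hsurj : ∀ x y z : ℤ, x ^ 2 + y ^ 2 + z ^ 2 ≤ 1 → (7 : ℤ) ∣ t - (x + 2 * y + 3 * z) →
        ∃ v : Fin 3 → ℤ, normSq v ≤ (1 : ℕ) ∧
          ((7 : ℕ) : ℤ) ∣ t - (1 * v 0 + 2 * v 1 + 3 * v 2) := by
      intro x y z h1 h2
      exact ⟨![x, y, z], by simpa [normSq] using h1, by simpa using h2⟩
    have : t % 7 = 0 ∨ t % 7 = 1 ∨ t % 7 = 2 ∨ t % 7 = 3 ∨ t % 7 = 4 ∨ t % 7 = 5 ∨ t % 7 = 6 := by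
      omega
    rcases this with h | h | h | h | h | h | h
    · exact hsurj 0 0 0 (by norm_num) (by omega)
    · exact hsurj 1 0 0 (by norm_num) (by omega)
    · exact hsurj 0 1 0 (by norm_num) (by omega)
    · exact hsurj 0 0 1 (by norm_num) (by omega)
    · exact hsurj 0 0 (-1) (by norm_num) (by omega)
    · exact hsurj 0 (-1) 0 (by norm_num) (by omega)
    · exact hsurj (-1) 0 0 (by norm_num) (by omega)

/-- The ball is the cube `{-1, 0, 1}³`, and `x + 3y + 9z` is balanced ternary notation for `-13, …,
13`. -/
lemma isTiling_three : IsTiling 3 (linHom 27 1 3 9).ker := by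
  have hball : ∀ v : Fin 3 → ℤ, normSq v ≤ (3 : ℕ) → ∀ i, -1 ≤ v i ∧ v i ≤ 1 := by
    intro v hv i
    simp only [normSq, Nat.cast_ofNat] at hv
    have : v i ^ 2 ≤ 3 := by
      fin_cases i <;> simp <;> linarith [sq_nonneg (v 0), sq_nonneg (v 1), sq_nonneg (v 2)]
    constructor <;> nlinarith
  apply isTiling_ker_linHom
  · intro v w hv hw h
    have hv := hball v hv
    have hw := hball w hw
    have := hv 0
    have := hv 1
    have := hv 2
    have := hw 0
    have := hw 1
    have := hw 2
    push_cast at h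
    ext i; fin_cases i <;> simp <;> omega
  · intro t
    have hb : ∀ x : ℤ, (x % 3 - 1) ^ 2 ≤ 1 := by
      intro x
      have : -1 ≤ x % 3 - 1 ∧ x % 3 - 1 ≤ 1 := by omega
      nlinarith
    -- Balanced digits are ordinary ternary digits minus 1, after a shift by `13 = 1 + 3 + 9`.
    refine ⟨![(t + 13) % 3 - 1, (t + 13) / 3 % 3 - 1, (t + 13) / 9 % 3 - 1], ?_, ?_⟩
    · simp only [normSq, Matrix.cons_val]
      push_cast
      linarith [hb (t + 13), hb ((t + 13) / 3), hb ((t + 13) / 9)]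
    · simp only [Matrix.cons_val]
      push_cast
      omega

end PerfectCode

theorem theorem3 :
    (∀ (Λ : AddSubgroup (Fin 3 → ℤ)) (r : ℝ), 0 < r →
      PerfectCode.IsRPerfect (Λ : Set (Fin 3 → ℤ)) r → r = 1 ∨ r = Real.sqrt 3) ∧
    (LinearIndependent ℤ PerfectCode.basisAlpha ∧
      AddSubgroup.closure (Set.range PerfectCode.basisAlpha)
        = (PerfectCode.linHom 7 1 2 3).ker ∧
      PerfectCode.IsRPerfect
        (AddSubgroup.closure (Set.range PerfectCode.basisAlpha) : Set (Fin 3 → ℤ)) 1) ∧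
    (LinearIndependent ℤ PerfectCode.basisBeta ∧
      AddSubgroup.closure (Set.range PerfectCode.basisBeta)
        = (PerfectCode.linHom 27 1 3 9).ker ∧
      PerfectCode.IsRPerfect
        (AddSubgroup.closure (Set.range PerfectCode.basisBeta) : Set (Fin 3 → ℤ))
        (Real.sqrt 3)) := by
  refine ⟨fun Λ r hr h => ?_, ⟨PerfectCode.linearIndependent_basisAlpha,
    PerfectCode.closure_basisAlpha, ?_⟩, PerfectCode.linearIndependent_basisBeta,
    PerfectCode.closure_basisBeta, ?_⟩
  · obtain ⟨n, hn, rfl, htile⟩ := h.exists_isTiling hr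
    rcases htile.eq_one_or_eq_three hn htile.lt_hundred with rfl | rfl
    · left; simp
    · right; simp
  · have h := PerfectCode.isTiling_one.isRPerfect one_pos (u := ![1, 0, 0])
      (by simp [PerfectCode.normSq])
    rw [PerfectCode.closure_basisAlpha]
    simpa using h
  · have h := PerfectCode.isTiling_three.isRPerfect three_pos (u := ![1, 1, 1])
      (by simp [PerfectCode.normSq])
    rw [PerfectCode.closure_basisBeta]
    simpa using h
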